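/- For a natural number $m\ge 1$ let $J_m(x)=\sum_{k\ge0}\frac{(-1)^k}{k!\,(k+m)!}(x/2)^{2k+m}$ be the Bessel function of the first kind, and for $0<e<1$ put \[ A_m(e)=\frac{4}{m^2e^2}\bigl(2me(1-e^2)J_m'(me)-(2-e^2)J_m(me)\bigr),\qquad B_m(e)=-\frac{8}{m^2e^2}\sqrt{1-e^2}\,\bigl(eJ_m'(me)-m(1-e^2)J_m(me)\bigr). \] Fix $L>0$ (the action variable determined by the resonance between the Kepler orbit and the incident wave). For $0<|G|<L$ let $e=\frac1L\sqrt{L^2-G^2}\in(0,1)$ be the eccentricity, and regard $A_m$ and $B_m$ as functions of $G$ through $e$. For wave parameters $(\alpha,\beta,\rho)\in\mathbb R^3$ let $\mathcal E,\mathcal F\ge0$ and the phases $\sigma,\tau$ be given by \[ \mathcal E\cos\sigma=\beta\cos\rho,\quad \mathcal E\sin\sigma=\alpha+\beta\sin\rho,\qquad \mathcal F\cos\tau=\beta\cos\rho,\quad \mathcal F\sin\tau=\alpha-\beta\sin\rho, \] so that $\mathcal E=(\alpha^2+\beta^2+2\alpha\beta\sin\rho)^{1/2}$ and $\mathcal F=(\alpha^2+\beta^2-2\alpha\beta\sin\rho)^{1/2}$.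 (If $\mathcal E=0$ or $\mathcal F=0$, the corresponding phase is immaterial; take it to be $0$.) The bifurcation system of the $(m:1)$ resonance is the system of three equations \begin{align*} \mathcal F(A_m+B_m)\cos(2g+m\ell+\tau)&=0,\\ \mathcal E(A_m-B_m)\cos(2g-m\ell+\sigma)&=0,\\ \Bigl(\frac{\partial A_m}{\partial G}+\frac{\partial B_m}{\partial G}\Bigr)\mathcal F\sin(2g+m\ell+\tau) +\Bigl(\frac{\partial A_m}{\partial G}-\frac{\partial B_m}{\partial G}\Bigr)\mathcal E\sin(2g-m\ell+\sigma)&=0 \tag{B} \end{align*} for $(G,\ell,g)$ with $0<|G|<L$ and the angles $\ell,g$ taken modulo $2\pi$ (represented in $[0,2\pi)$). A zero of (B) is called simple if the derivative, with respect to $(G,\ell,g)$, of the map $\mathbb R^3\to\mathbb R^3$ formed by the three left-hand sides is invertible at it. Proposition (the $(1:1)$ resonance). Let $m=1$ and $L>0$. (1) There is an open dense set $U\subset\mathbb R^3$ such that for every $(\alpha,\beta,\rho)\in U$ the zero set of (B) is nonempty, finite, and consists only of simple zeros. (2) If $\alpha^2+\beta^2\ne0$ and $\alpha\beta\sin\rho=0$,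 then the zero set of (B) is nonempty, finite, and consists only of simple zeros. -/

import Mathlib

open scoped Nat

namespace KeplerWave

/-! ### Bessel functions of the first kind of integer order -/

/-- The term of index `k` of the power series of the Bessel function `J_n`. -/
noncomputable def besselTerm (n : ℕ) (x : ℝ) (k : ℕ) : ℝ :=
  (-1) ^ k / ((k ! : ℝ) * ((k + n)! : ℝ)) * (x / 2) ^ (2 * k + n)

/-- The Bessel function of the first kind `J_n`, for a natural number `n`. -/
noncomputable def besselJ (n : ℕ) (x : ℝ) : ℝ :=
  ∑' k : ℕ, besselTerm n x k

/-- The series defining `J_n` converges everywhere. -/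
theorem summable_besselTerm (n : ℕ) (x : ℝ) : Summable (besselTerm n x) := by
  have h : Summable fun k : ℕ => |x / 2| ^ n * ((|x / 2| ^ 2) ^ k / (k ! : ℝ)) :=
    (Real.summable_pow_div_factorial (|x / 2| ^ 2)).mul_left _
  refine Summable.of_norm_bounded h fun k => ?_
  have h1 : (1 : ℝ) ≤ ((k + n)! : ℝ) := by exact_mod_cast Nat.one_le_iff_ne_zero.2 (Nat.factorial_ne_zero _)
  have h2 : (0 : ℝ) < (k ! : ℝ) := by exact_mod_cast Nat.factorial_pos k
  have h3 : (k ! : ℝ) ≤ (k ! : ℝ) * ((k + n)! : ℝ) := by nlinarith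
  have e1 : ‖besselTerm n x k‖ =
      (|x / 2| ^ n * (|x / 2| ^ 2) ^ k) / ((k ! : ℝ) * ((k + n)! : ℝ)) := by
    simp only [besselTerm, norm_mul, norm_div, norm_pow, norm_neg, norm_one, one_pow,
      Real.norm_eq_abs, Nat.abs_cast, abs_div]
    rw [pow_add, pow_mul]
    ring
  rw [e1, ← mul_div_assoc]
  exact div_le_div_of_nonneg_left (by positivity) h2 h3

/-! ### Fourier coefficients of the perturbation along a Kepler ellipse -/

/-- The eccentricity of the Kepler ellipse with actions `L`, `G`. -/
noncomputable def ecc (L G : ℝ) : ℝ := √(L ^ 2 - G ^ 2) / L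

/-- The coefficient `A_m` as a function of the eccentricity. -/
noncomputable def coeffA (m : ℕ) (e : ℝ) : ℝ :=
  4 / ((m : ℝ) ^ 2 * e ^ 2) *
    (2 * m * e * (1 - e ^ 2) * deriv (besselJ m) (m * e) - (2 - e ^ 2) * besselJ m (m * e))

/-- The coefficient `B_m` as a function of the eccentricity. -/
noncomputable def coeffB (m : ℕ) (e : ℝ) : ℝ :=
  -(8 / ((m : ℝ) ^ 2 * e ^ 2)) * √(1 - e ^ 2) *
    (e * deriv (besselJ m) (m * e) - m * (1 - e ^ 2) * besselJ m (m * e))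

/-- `A_m` as a function of the actions. -/
noncomputable def actA (m : ℕ) (L G : ℝ) : ℝ := coeffA m (ecc L G)

/-- `B_m` as a function of the actions. -/
noncomputable def actB (m : ℕ) (L G : ℝ) : ℝ := coeffB m (ecc L G)

/-- The partial derivative `∂A_m/∂G`. -/
noncomputable def actA_G (m : ℕ) (L G : ℝ) : ℝ := deriv (fun G' : ℝ => actA m L G') G

/-- The partial derivative `∂B_m/∂G`. -/
noncomputable def actB_G (m : ℕ) (L G : ℝ) : ℝ := deriv (fun G' : ℝ => actB m L G') G

/-! ### Amplitudes and phases of the wave -/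

/-- The amplitude `ℰ`. -/
noncomputable def ampE (α β ρ : ℝ) : ℝ := √(α ^ 2 + β ^ 2 + 2 * α * β * Real.sin ρ)

/-- The amplitude `ℱ`. -/
noncomputable def ampF (α β ρ : ℝ) : ℝ := √(α ^ 2 + β ^ 2 - 2 * α * β * Real.sin ρ)

/-- The phase `σ`: `ℰ cos σ = β cos ρ`, `ℰ sin σ = α + β sin ρ`. -/
noncomputable def phaseE (α β ρ : ℝ) : ℝ :=
  Complex.arg ⟨β * Real.cos ρ, α + β * Real.sin ρ⟩

/-- The phase `τ`: `ℱ cos τ = β cos ρ`, `ℱ sin τ = α - β sin ρ`. -/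
noncomputable def phaseF (α β ρ : ℝ) : ℝ :=
  Complex.arg ⟨β * Real.cos ρ, α - β * Real.sin ρ⟩

theorem ampE_eq_norm (α β ρ : ℝ) :
    ampE α β ρ = ‖(⟨β * Real.cos ρ, α + β * Real.sin ρ⟩ : ℂ)‖ := by
  rw [Complex.norm_def, Complex.normSq_mk, ampE]
  congr 1
  linear_combination (-β ^ 2) * Real.sin_sq_add_cos_sq ρ

theorem ampF_eq_norm (α β ρ : ℝ) :
    ampF α β ρ = ‖(⟨β * Real.cos ρ, α - β * Real.sin ρ⟩ : ℂ)‖ := by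
  rw [Complex.norm_def, Complex.normSq_mk, ampF]
  congr 1
  linear_combination (-β ^ 2) * Real.sin_sq_add_cos_sq ρ

theorem ampE_mul_cos_phaseE (α β ρ : ℝ) :
    ampE α β ρ * Real.cos (phaseE α β ρ) = β * Real.cos ρ := by
  rw [ampE_eq_norm, phaseE, Complex.norm_mul_cos_arg]

theorem ampE_mul_sin_phaseE (α β ρ : ℝ) :
    ampE α β ρ * Real.sin (phaseE α β ρ) = α + β * Real.sin ρ := by
  rw [ampE_eq_norm, phaseE, Complex.norm_mul_sin_arg]

theorem ampF_mul_cos_phaseF (α β ρ : ℝ) :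
    ampF α β ρ * Real.cos (phaseF α β ρ) = β * Real.cos ρ := by
  rw [ampF_eq_norm, phaseF, Complex.norm_mul_cos_arg]

theorem ampF_mul_sin_phaseF (α β ρ : ℝ) :
    ampF α β ρ * Real.sin (phaseF α β ρ) = α - β * Real.sin ρ := by
  rw [ampF_eq_norm, phaseF, Complex.norm_mul_sin_arg]

/-! ### The bifurcation system -/

/-- The left-hand sides of the bifurcation system of the `(m : 1)` resonance, as a map of
`(G, ℓ, g)`; `L` is fixed by the resonance. -/
noncomputable def bifSystem (m : ℕ) (L α β ρ : ℝ) (z : ℝ × ℝ × ℝ) : ℝ × ℝ × ℝ :=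
  let G := z.1
  let l := z.2.1
  let g := z.2.2
  (ampF α β ρ * (actA m L G + actB m L G) * Real.cos (2 * g + m * l + phaseF α β ρ),
   ampE α β ρ * (actA m L G - actB m L G) * Real.cos (2 * g - m * l + phaseE α β ρ),
   (actA_G m L G + actB_G m L G) * ampF α β ρ * Real.sin (2 * g + m * l + phaseF α β ρ) +
   (actA_G m L G - actB_G m L G) * ampE α β ρ * Real.sin (2 * g - m * l + phaseE α β ρ))

/-- The noncircular Kepler ellipses of action `L`: `0 < |G| < L`, that is `0 < e < 1`, and the
angles `ℓ`, `g`, defined modulo `2π`, are represented in `[0, 2π)`. -/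
def keplerDomain (L : ℝ) : Set (ℝ × ℝ × ℝ) :=
  {z | 0 < |z.1| ∧ |z.1| < L ∧ z.2.1 ∈ Set.Ico 0 (2 * Real.pi) ∧
    z.2.2 ∈ Set.Ico 0 (2 * Real.pi)}

/-- The zero set of the bifurcation system. -/
def bifZeros (m : ℕ) (L α β ρ : ℝ) : Set (ℝ × ℝ × ℝ) :=
  {z | z ∈ keplerDomain L ∧ bifSystem m L α β ρ z = 0}

/-- `z` is a simple zero of `F`: `F z = 0`, and `F` is differentiable at `z` with an invertible
derivative. -/
def IsSimpleZero (F : ℝ × ℝ × ℝ → ℝ × ℝ × ℝ) (z : ℝ × ℝ × ℝ) : Prop :=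
  F z = 0 ∧ ∃ D : (ℝ × ℝ × ℝ) ≃L[ℝ] (ℝ × ℝ × ℝ),
    HasFDerivAt F (D : (ℝ × ℝ × ℝ) →L[ℝ] (ℝ × ℝ × ℝ)) z

/-- The zero set of the bifurcation system is nonempty and finite, and consists of simple zeros. -/
def HasFiniteSimpleZeros (m : ℕ) (L α β ρ : ℝ) : Prop :=
  (bifZeros m L α β ρ).Nonempty ∧ (bifZeros m L α β ρ).Finite ∧
    ∀ z ∈ bifZeros m L α β ρ, IsSimpleZero (bifSystem m L α β ρ) z

end KeplerWave

/-! Put γ = |G|/L and x = e² = 1 - γ², and write J_n(e) = eⁿ b_n(e²) with b_n entire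
(`besselEntire`). Both A_1 + B_1 and A_1 - B_1 are negative for 0 < γ < 1, so when ℰ and ℱ are
positive the first two equations say that the two cosines vanish. The sines are then ±1. Up to a
common nonvanishing factor, the G-derivatives of A_1 ± B_1 are S(γ) = `slopeSum` and D(γ) =
`slopeDiff`, so the third equation becomes S ± cD = 0 with c = ℰ/ℱ. At a zero the Jacobian splits
into an invertible (ℓ, g) block and a G entry, so simplicity follows from simplicity of the zero γ
of S ± cD (`isSimpleZero_trig`).

Existence holds for every c > 0: S(0) = -D(0) < 0, while D(1) = 0 < S(1), so S - cD changes sign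
(`exists_slopeSum_eq`). Simple zeros on the compact interval [0, 1] are finite in number. Since D >
0 on [0, 1), all zeros of S + tD are simple exactly when -t is a regular value of S/D there. By Sard
this holds for almost every t, and by compactness for an open set of t. As ρ ↦ ℰ/ℱ is locally open
at generic parameters, (1) follows.

In (2), αβ sin ρ = 0 forces ℰ = ℱ, hence c = 1. Then S + D = 2γ a(x) and S - D = -4 b(x), where a =
`slopeA` is strictly decreasing and b = `slopeB` strictly increasing on [0, 1], and simplicity can
be read off. All signs come from crude enclosures of b_1, b_2, b_3 on [0, 1] and the three-term
recurrence. -/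

namespace KeplerWave

open Set Filter Topology MeasureTheory

/-! ### Bessel functions as entire functions of the squared argument -/

/-- The entire function `x ↦ J_n(√x) / √x ^ n`. -/
noncomputable def besselEntire (n : ℕ) (x : ℝ) : ℝ :=
  ∑' k : ℕ, (-1) ^ k / ((k ! : ℝ) * ((k + n)! : ℝ) * 2 ^ (2 * k + n)) * x ^ k

theorem abs_besselEntire_coeff_le (n k : ℕ) :
    |(-1 : ℝ) ^ k / ((k ! : ℝ) * ((k + n)! : ℝ) * 2 ^ (2 * k + n))| ≤
      1 / (2 ^ n * (n ! : ℝ)) * (1 / 4) ^ k / (k ! : ℝ) := by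
  rw [abs_div, abs_pow, abs_neg, abs_one, one_pow, abs_of_pos (by positivity)]
  have h1 : (n ! : ℝ) ≤ ((k + n)! : ℝ) := by
    exact_mod_cast Nat.factorial_le (Nat.le_add_left n k)
  have h2 : 1 / (2 ^ n * (n ! : ℝ)) * (1 / 4) ^ k / (k ! : ℝ) =
      1 / ((k ! : ℝ) * (n ! : ℝ) * 2 ^ (2 * k + n)) := by
    rw [pow_add, pow_mul, div_pow, one_pow]
    norm_num
    ring
  rw [h2]
  gcongr

theorem summable_besselEntire (n : ℕ) (x : ℝ) :
    Summable fun k : ℕ =>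
      (-1 : ℝ) ^ k / ((k ! : ℝ) * ((k + n)! : ℝ) * 2 ^ (2 * k + n)) * x ^ k := by
  refine Summable.of_norm_bounded
    (((Real.summable_pow_div_factorial (|x| / 4)).mul_left (1 / (2 ^ n * (n ! : ℝ))))) fun k => ?_
  rw [norm_mul, norm_pow, Real.norm_eq_abs, Real.norm_eq_abs]
  calc _ ≤ 1 / (2 ^ n * (n ! : ℝ)) * (1 / 4) ^ k / (k ! : ℝ) * |x| ^ k := by
        gcongr
        exact abs_besselEntire_coeff_le n k
    _ = _ := by rw [div_pow, div_pow]; ring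

/-- Termwise differentiation, dominated on a ball around 0 containing x. This is the classical (x⁻ⁿ
J_n)' = -x⁻ⁿ J_{n+1} in the variable x². -/
theorem hasDerivAt_besselEntire (n : ℕ) (x : ℝ) :
    HasDerivAt (besselEntire n) (-besselEntire (n + 1) x / 2) x := by
  set c : ℕ → ℝ := fun k => (-1 : ℝ) ^ k / ((k ! : ℝ) * ((k + n)! : ℝ) * 2 ^ (2 * k + n)) with hc
  set R : ℝ := |x| + 1 with hR
  have hR0 : 0 < R := by positivity
  have hcle (k : ℕ) : |c k| ≤ 1 / (k ! : ℝ) := by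
    rw [hc, abs_div, abs_pow, abs_neg, abs_one, one_pow, abs_of_pos (by positivity)]
    have h1 : (1 : ℝ) ≤ ((k + n)! : ℝ) := by exact_mod_cast Nat.factorial_pos _
    have h2 : (1 : ℝ) ≤ 2 ^ (2 * k + n) := one_le_pow₀ (by norm_num)
    have h3 : (0 : ℝ) < (k ! : ℝ) := by positivity
    gcongr
    calc (k ! : ℝ) = (k ! : ℝ) * 1 * 1 := by ring
      _ ≤ _ := by gcongr
  have hu : Summable fun k : ℕ => (k : ℝ) / (k ! : ℝ) * R ^ (k - 1) := by
    rw [← summable_nat_add_iff 1]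
    refine (Real.summable_pow_div_factorial R).congr fun k => ?_
    rw [Nat.factorial_succ]
    push_cast
    field_simp
  have hmem : x ∈ Metric.ball (0 : ℝ) R := by simp [hR]
  have key := hasDerivAt_tsum_of_isPreconnected (g := fun k y => c k * y ^ k)
    (g' := fun k y => c k * ((k : ℝ) * y ^ (k - 1))) hu Metric.isOpen_ball
    (convex_ball (0 : ℝ) R).isPreconnected
    (fun k y _ => (hasDerivAt_pow k y).const_mul (c k))
    (fun k y hy => by
      have hy' : |y| ≤ R := by simpa using (Metric.mem_ball.1 hy).le
      rw [norm_mul, norm_mul, norm_pow, Real.norm_eq_abs, Real.norm_eq_abs, Real.norm_eq_abs,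
        Nat.abs_cast]
      calc _ ≤ 1 / (k ! : ℝ) * ((k : ℝ) * R ^ (k - 1)) := by
            gcongr
            exact hcle k
        _ = _ := by ring)
    hmem (summable_besselEntire n x) hmem
  have e : ∑' k : ℕ, c k * ((k : ℝ) * x ^ (k - 1)) = -besselEntire (n + 1) x / 2 := by
    have hs : Summable fun k : ℕ => c k * ((k : ℝ) * x ^ (k - 1)) := by
      refine Summable.of_norm_bounded hu fun k => ?_
      rw [norm_mul, norm_mul, norm_pow, Real.norm_eq_abs, Real.norm_eq_abs, Real.norm_eq_abs,
        Nat.abs_cast]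
      calc _ ≤ 1 / (k ! : ℝ) * ((k : ℝ) * R ^ (k - 1)) := by
            gcongr
            · exact hcle k
            · simp [hR]
        _ = _ := by ring
    rw [hs.tsum_eq_zero_add, besselEntire, neg_div, ← tsum_div_const, ← tsum_neg]
    simp only [Nat.cast_zero, zero_mul, mul_zero, zero_add]
    refine tsum_congr fun k => ?_
    simp only [hc]
    rw [show k + 1 + n = k + (n + 1) by ring, Nat.factorial_succ k,
      show 2 * (k + 1) + n = 2 * k + (n + 1) + 1 by ring, pow_succ (-1 : ℝ), pow_succ (2 : ℝ)]
    simp only [add_tsub_cancel_right]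
    push_cast
    field_simp
  rw [e] at key
  exact key

theorem continuous_besselEntire (n : ℕ) : Continuous (besselEntire n) :=
  continuous_iff_continuousAt.2 fun x => (hasDerivAt_besselEntire n x).continuousAt

/-- The three-term recurrence of the Bessel functions. -/
theorem besselEntire_recurrence (n : ℕ) (x : ℝ) :
    besselEntire n x + x * besselEntire (n + 2) x = 2 * (n + 1) * besselEntire (n + 1) x := by
  have h0 := summable_besselEntire n x
  have h1 := summable_besselEntire (n + 1) x
  have h2 := summable_besselEntire (n + 2) x
  simp only [besselEntire]
  rw [h0.tsum_eq_zero_add, h1.tsum_eq_zero_add, ← tsum_mul_left, mul_add, ← tsum_mul_left, add_assoc,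
    ← ((summable_nat_add_iff 1).2 h0).tsum_add (h2.mul_left x)]
  congr 1
  · simp only [zero_add, mul_zero, Nat.factorial_zero, pow_zero, Nat.factorial_succ, pow_succ]
    push_cast
    field_simp
  · refine tsum_congr fun k => ?_
    rw [show k + (n + 2) = k + n + 2 by ring, show k + 1 + n = k + n + 1 by ring,
      show k + 1 + (n + 1) = k + n + 2 by ring, show 2 * (k + 1) + n = 2 * k + n + 2 by ring,
      show 2 * k + (n + 2) = 2 * k + n + 2 by ring,
      show 2 * (k + 1) + (n + 1) = 2 * k + n + 3 by ring]
    simp only [Nat.factorial_succ, pow_succ]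
    push_cast
    field_simp
    ring

/-- Relative to the leading term, the k-th term is at most 4⁻ᵏ, and these sum to 1/3 over k ≥ 1. -/
theorem abs_besselEntire_sub_le (n : ℕ) {x : ℝ} (hx : x ∈ Set.Icc (0 : ℝ) 1) :
    |besselEntire n x - 1 / (2 ^ n * (n ! : ℝ))| ≤ 1 / (2 ^ n * (n ! : ℝ)) / 3 := by
  have h0 := summable_besselEntire n x
  have e : besselEntire n x - 1 / (2 ^ n * (n ! : ℝ)) = ∑' k : ℕ,
      (-1 : ℝ) ^ (k + 1) / (((k + 1)! : ℝ) * ((k + 1 + n)! : ℝ) * 2 ^ (2 * (k + 1) + n)) *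
        x ^ (k + 1) := by
    rw [besselEntire, h0.tsum_eq_zero_add]
    simp [mul_comm]
  have hg : HasSum (fun k : ℕ => 1 / (2 ^ n * (n ! : ℝ)) * (1 / 4) * (1 / 4 : ℝ) ^ k)
      (1 / (2 ^ n * (n ! : ℝ)) / 3) := by
    have := (hasSum_geometric_of_lt_one (r := (1 / 4 : ℝ)) (by norm_num) (by norm_num)).mul_left
      (1 / (2 ^ n * (n ! : ℝ)) * (1 / 4))
    rwa [show 1 / (2 ^ n * (n ! : ℝ)) * (1 / 4) * (1 - 1 / 4 : ℝ)⁻¹ = 1 / (2 ^ n * (n ! : ℝ)) / 3 by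
      rw [show (1 - 1 / 4 : ℝ)⁻¹ = 4 / 3 by norm_num]; ring] at this
  rw [e, ← Real.norm_eq_abs]
  refine tsum_of_norm_bounded hg fun k => ?_
  rw [norm_mul, norm_pow, Real.norm_eq_abs, Real.norm_eq_abs, abs_of_nonneg hx.1]
  have h1 : (1 : ℝ) ≤ ((k + 1)! : ℝ) := by exact_mod_cast Nat.factorial_pos _
  calc _ ≤ 1 / (2 ^ n * (n ! : ℝ)) * (1 / 4) ^ (k + 1) / ((k + 1)! : ℝ) * 1 := by
        gcongr
        · exact pow_nonneg hx.1 _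
        · exact abs_besselEntire_coeff_le n (k + 1)
        · exact pow_le_one₀ hx.1 hx.2
    _ ≤ 1 / (2 ^ n * (n ! : ℝ)) * (1 / 4) ^ (k + 1) := by
        rw [mul_one]
        exact div_le_self (by positivity) h1
    _ = _ := by rw [pow_succ]; ring

theorem besselEntire_one_mem {x : ℝ} (hx : x ∈ Set.Icc (0 : ℝ) 1) :
    besselEntire 1 x ∈ Set.Icc (1 / 3 : ℝ) (2 / 3) := by
  have h := abs_le.1 (abs_besselEntire_sub_le 1 hx)
  norm_num at h
  constructor <;> linarith [h.1, h.2]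

theorem besselEntire_two_mem {x : ℝ} (hx : x ∈ Set.Icc (0 : ℝ) 1) :
    besselEntire 2 x ∈ Set.Icc (1 / 12 : ℝ) (1 / 6) := by
  have h := abs_le.1 (abs_besselEntire_sub_le 2 hx)
  norm_num at h
  constructor <;> linarith [h.1, h.2]

theorem besselEntire_three_mem {x : ℝ} (hx : x ∈ Set.Icc (0 : ℝ) 1) :
    besselEntire 3 x ∈ Set.Icc (1 / 72 : ℝ) (1 / 36) := by
  have h := abs_le.1 (abs_besselEntire_sub_le 3 hx)
  norm_num [Nat.factorial] at h
  constructor <;> linarith [h.1, h.2]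

theorem besselJ_eq (n : ℕ) (x : ℝ) : besselJ n x = x ^ n * besselEntire n (x ^ 2) := by
  rw [besselJ, besselEntire, ← tsum_mul_left]
  refine tsum_congr fun k => ?_
  rw [besselTerm, div_pow, pow_add x, pow_mul x]
  field_simp

theorem deriv_besselJ_one (x : ℝ) :
    deriv (besselJ 1) x = besselEntire 1 (x ^ 2) - x ^ 2 * besselEntire 2 (x ^ 2) := by
  have e : besselJ 1 = fun y : ℝ => y * besselEntire 1 (y ^ 2) := by
    funext y
    rw [besselJ_eq, pow_one]
  rw [e]
  have h := (hasDerivAt_id x).mul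
    ((hasDerivAt_besselEntire 1 (x ^ 2)).comp x (hasDerivAt_pow 2 x))
  refine (h.congr_deriv ?_).deriv
  simp
  ring

/-! ### The derivatives of the coefficients `A_1` and `B_1` -/

/-- With `γ = |G| / L` and `x = e² = 1 - γ²`, one has `e * ∂A_1/∂γ = 4 * γ * slopeA x`. -/
noncomputable def slopeA (x : ℝ) : ℝ :=
  (3 - 2 * x) * besselEntire 1 x - (6 - x) * besselEntire 2 x

/-- With `γ = |G| / L` and `x = e² = 1 - γ²`, one has `e * ∂B_1/∂γ = -8 * slopeB x`. -/
noncomputable def slopeB (x : ℝ) : ℝ :=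
  x * besselEntire 1 x - (3 - 3 * x + x ^ 2) * besselEntire 2 x

/-- The derivative of `slopeA`. -/
noncomputable def slopeA' (x : ℝ) : ℝ :=
  -2 * besselEntire 1 x + (x - 1 / 2) * besselEntire 2 x + (3 - x / 2) * besselEntire 3 x

/-- The derivative of `slopeB`. -/
noncomputable def slopeB' (x : ℝ) : ℝ :=
  besselEntire 1 x + (3 - 5 / 2 * x) * besselEntire 2 x
    + (3 - 3 * x + x ^ 2) / 2 * besselEntire 3 x

theorem hasDerivAt_slopeA (x : ℝ) : HasDerivAt slopeA (slopeA' x) x := by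
  have h := ((((hasDerivAt_id x).const_mul 2).const_sub 3).mul (hasDerivAt_besselEntire 1 x)).sub
    (((hasDerivAt_id x).const_sub 6).mul (hasDerivAt_besselEntire 2 x))
  refine h.congr_deriv ?_
  simp [slopeA']
  ring

theorem hasDerivAt_slopeB (x : ℝ) : HasDerivAt slopeB (slopeB' x) x := by
  have h := ((hasDerivAt_id x).mul (hasDerivAt_besselEntire 1 x)).sub
    (((((hasDerivAt_id x).const_mul 3).const_sub 3).add (hasDerivAt_pow 2 x)).mul
      (hasDerivAt_besselEntire 2 x))
  refine h.congr_deriv ?_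
  simp [slopeB']
  ring

theorem continuous_slopeA' : Continuous slopeA' := by
  have h1 := continuous_besselEntire 1
  have h2 := continuous_besselEntire 2
  have h3 := continuous_besselEntire 3
  unfold slopeA'
  fun_prop

theorem continuous_slopeB' : Continuous slopeB' := by
  have h1 := continuous_besselEntire 1
  have h2 := continuous_besselEntire 2
  have h3 := continuous_besselEntire 3
  unfold slopeB'
  fun_prop

/-- Eliminating b_1 makes exact cancellations visible where the enclosures alone are too crude to
give a sign. -/
theorem besselEntire_one_eq (x : ℝ) :
    besselEntire 1 x = 4 * besselEntire 2 x - x * besselEntire 3 x := by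
  have h := besselEntire_recurrence 1 x
  norm_num at h
  linarith

theorem slopeA'_neg {x : ℝ} (hx : x ∈ Icc (0 : ℝ) 1) : slopeA' x < 0 := by
  obtain ⟨v1, v2⟩ := besselEntire_one_mem hx
  obtain ⟨w1, w2⟩ := besselEntire_two_mem hx
  obtain ⟨z1, z2⟩ := besselEntire_three_mem hx
  obtain ⟨x1, x2⟩ := hx
  unfold slopeA'
  nlinarith [mul_nonneg (sub_nonneg.2 x2) (by linarith : 0 ≤ besselEntire 2 x),
    mul_nonneg x1 (by linarith : 0 ≤ besselEntire 3 x)]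

theorem slopeB'_pos {x : ℝ} (hx : x ∈ Icc (0 : ℝ) 1) : 0 < slopeB' x := by
  obtain ⟨v1, v2⟩ := besselEntire_one_mem hx
  obtain ⟨w1, w2⟩ := besselEntire_two_mem hx
  obtain ⟨z1, z2⟩ := besselEntire_three_mem hx
  obtain ⟨x1, x2⟩ := hx
  unfold slopeB'
  have h1 : 0 ≤ (3 - 5 / 2 * x) * besselEntire 2 x := mul_nonneg (by linarith) (by linarith)
  have h2 : 0 ≤ (3 - 3 * x + x ^ 2) / 2 * besselEntire 3 x :=
    mul_nonneg (by nlinarith) (by linarith)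
  linarith

/-- By the recurrence the value is -b_2(1) - b_3(1). -/
theorem slopeA_one_neg : slopeA 1 < 0 := by
  have h := besselEntire_one_eq 1
  obtain ⟨w1, w2⟩ := besselEntire_two_mem (x := 1) (by norm_num)
  obtain ⟨z1, z2⟩ := besselEntire_three_mem (x := 1) (by norm_num)
  unfold slopeA
  linarith

theorem slopeB_one_pos : 0 < slopeB 1 := by
  obtain ⟨v1, v2⟩ := besselEntire_one_mem (x := 1) (by norm_num)
  obtain ⟨w1, w2⟩ := besselEntire_two_mem (x := 1) (by norm_num)
  unfold slopeB
  linarith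

/-! ### Slopes of A_1 + B_1 and A_1 - B_1 in the variable γ -/

/-- With `γ = |G| / L`, one has `e * ∂(A_1 + B_1)/∂γ = 4 * slopeSum γ`. -/
noncomputable def slopeSum (γ : ℝ) : ℝ := γ * slopeA (1 - γ ^ 2) - 2 * slopeB (1 - γ ^ 2)

/-- With `γ = |G| / L`, one has `e * ∂(A_1 - B_1)/∂γ = 4 * slopeDiff γ`. -/
noncomputable def slopeDiff (γ : ℝ) : ℝ := γ * slopeA (1 - γ ^ 2) + 2 * slopeB (1 - γ ^ 2)

/-- The derivative of `slopeSum`. -/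
noncomputable def slopeSum' (γ : ℝ) : ℝ :=
  slopeA (1 - γ ^ 2) - 2 * γ ^ 2 * slopeA' (1 - γ ^ 2) + 4 * γ * slopeB' (1 - γ ^ 2)

/-- The derivative of `slopeDiff`. -/
noncomputable def slopeDiff' (γ : ℝ) : ℝ :=
  slopeA (1 - γ ^ 2) - 2 * γ ^ 2 * slopeA' (1 - γ ^ 2) - 4 * γ * slopeB' (1 - γ ^ 2)

theorem hasDerivAt_one_sub_sq (γ : ℝ) : HasDerivAt (fun y : ℝ => 1 - y ^ 2) (-(2 * γ)) γ := by
  simpa using (hasDerivAt_pow 2 γ).const_sub 1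

theorem hasDerivAt_slopeSum (γ : ℝ) : HasDerivAt slopeSum (slopeSum' γ) γ := by
  have h := ((hasDerivAt_id γ).mul
      ((hasDerivAt_slopeA (1 - γ ^ 2)).comp γ (hasDerivAt_one_sub_sq γ))).sub
    (((hasDerivAt_slopeB (1 - γ ^ 2)).comp γ (hasDerivAt_one_sub_sq γ)).const_mul 2)
  refine h.congr_deriv ?_
  simp [slopeSum']
  ring

theorem hasDerivAt_slopeDiff (γ : ℝ) : HasDerivAt slopeDiff (slopeDiff' γ) γ := by
  have h := ((hasDerivAt_id γ).mul
      ((hasDerivAt_slopeA (1 - γ ^ 2)).comp γ (hasDerivAt_one_sub_sq γ))).add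
    (((hasDerivAt_slopeB (1 - γ ^ 2)).comp γ (hasDerivAt_one_sub_sq γ)).const_mul 2)
  refine h.congr_deriv ?_
  simp [slopeDiff']
  ring

theorem continuous_slopeSum : Continuous slopeSum :=
  continuous_iff_continuousAt.2 fun γ => (hasDerivAt_slopeSum γ).continuousAt

theorem continuous_slopeDiff : Continuous slopeDiff :=
  continuous_iff_continuousAt.2 fun γ => (hasDerivAt_slopeDiff γ).continuousAt

theorem continuous_slopeA : Continuous slopeA :=
  continuous_iff_continuousAt.2 fun γ => (hasDerivAt_slopeA γ).continuousAt

theorem continuous_slopeSum' : Continuous slopeSum' := by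
  have h1 := continuous_slopeA
  have h2 := continuous_slopeA'
  have h3 := continuous_slopeB'
  unfold slopeSum'
  fun_prop

theorem continuous_slopeDiff' : Continuous slopeDiff' := by
  have h1 := continuous_slopeA
  have h2 := continuous_slopeA'
  have h3 := continuous_slopeB'
  unfold slopeDiff'
  fun_prop

theorem one_sub_sq_mem {γ : ℝ} (hγ : γ ∈ Icc (0 : ℝ) 1) : 1 - γ ^ 2 ∈ Icc (0 : ℝ) 1 :=
  ⟨by nlinarith [hγ.1, hγ.2], by nlinarith [hγ.1, hγ.2]⟩

/-- Factoring out 1 - γ isolates the zero at γ = 1 and leaves a cofactor that the enclosures keep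
positive. -/
theorem slopeDiff_eq (γ : ℝ) : slopeDiff γ = (1 - γ) *
    ((6 + 5 * γ - 5 * γ ^ 2 + 2 * γ ^ 3) * besselEntire 2 (1 - γ ^ 2) -
      (1 + γ) * (2 + γ - 2 * γ ^ 2 + 2 * γ ^ 3) * besselEntire 3 (1 - γ ^ 2)) := by
  rw [slopeDiff, slopeA, slopeB, besselEntire_one_eq]
  ring

theorem slopeDiff_pos {γ : ℝ} (h0 : 0 ≤ γ) (h1 : γ < 1) : 0 < slopeDiff γ := by
  have hx := one_sub_sq_mem ⟨h0, h1.le⟩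
  obtain ⟨w1, w2⟩ := besselEntire_two_mem hx
  obtain ⟨z1, z2⟩ := besselEntire_three_mem hx
  have hq : γ ^ 2 ≤ γ := by nlinarith
  have hc : γ ^ 3 ≤ γ ^ 2 := by nlinarith [mul_nonneg (sq_nonneg γ) (sub_nonneg.2 h1.le)]
  have hc0 : 0 ≤ γ ^ 3 := by positivity
  rw [slopeDiff_eq]
  refine mul_pos (by linarith) ?_
  -- The cofactor is at least 6/12 - 6/36 > 0.
  have e1 : 6 * (1 / 12) ≤ (6 + 5 * γ - 5 * γ ^ 2 + 2 * γ ^ 3) * besselEntire 2 (1 - γ ^ 2) :=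
    mul_le_mul (by linarith) w1 (by norm_num) (by linarith)
  have e2 : (1 + γ) * (2 + γ - 2 * γ ^ 2 + 2 * γ ^ 3) ≤ 2 * 3 :=
    mul_le_mul (by linarith) (by linarith) (by linarith) (by norm_num)
  have e3 : (1 + γ) * (2 + γ - 2 * γ ^ 2 + 2 * γ ^ 3) * besselEntire 3 (1 - γ ^ 2) ≤
      2 * 3 * (1 / 36) := mul_le_mul e2 z2 (by linarith) (by norm_num)
  linarith

theorem slopeDiff_one : slopeDiff 1 = 0 := by simp [slopeDiff_eq]

theorem slopeSum_one_pos : 0 < slopeSum 1 := by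
  have h := besselEntire_one_eq 0
  obtain ⟨w1, w2⟩ := besselEntire_two_mem (x := 0) (by norm_num)
  norm_num [slopeSum, slopeA, slopeB]
  linarith

theorem slopeSum_zero : slopeSum 0 = -slopeDiff 0 := by simp [slopeSum, slopeDiff]

/-! ### Regular values of the quotient of the slopes -/

/-- The `t` such that `slopeSum + t * slopeDiff` has only simple zeros in `[0, 1]`. -/
def simpleRatios : Set ℝ :=
  {t | ∀ γ ∈ Icc (0 : ℝ) 1, slopeSum γ + t * slopeDiff γ = 0 → slopeSum' γ + t * slopeDiff' γ ≠ 0}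

/-- Here S + D = 2γ a(1 - γ²). The zero at γ = 0 is simple because a(1) < 0, and the others because
a' < 0. -/
theorem one_mem_simpleRatios : (1 : ℝ) ∈ simpleRatios := by
  intro γ hγ h h'
  have hA := slopeA'_neg (one_sub_sq_mem hγ)
  simp only [slopeSum, slopeDiff, slopeSum', slopeDiff'] at h h'
  have e : γ * slopeA (1 - γ ^ 2) = 0 := by linarith
  rcases hγ.1.eq_or_lt with rfl | h0
  · norm_num at h'
    linarith [slopeA_one_neg]
  · rw [(mul_eq_zero.1 e).resolve_left h0.ne'] at h'
    have : 0 < γ ^ 2 := by positivity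
    nlinarith

/-- Here S - D = -4 b(1 - γ²), which is nonzero at γ = 0 as b(1) > 0; elsewhere b' > 0 gives a
nonzero derivative. -/
theorem neg_one_mem_simpleRatios : (-1 : ℝ) ∈ simpleRatios := by
  intro γ hγ h h'
  have hB := slopeB'_pos (one_sub_sq_mem hγ)
  simp only [slopeSum, slopeDiff, slopeSum', slopeDiff'] at h h'
  rcases hγ.1.eq_or_lt with rfl | h0
  · norm_num at h
    linarith [slopeB_one_pos]
  · nlinarith

/-- Having no multiple zero at γ is an open condition on (t, γ), and compactness of [0, 1] makes it
uniform in γ. This is why both endpoints are included. -/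
theorem isOpen_simpleRatios : IsOpen simpleRatios := by
  rw [isOpen_iff_eventually]
  intro t ht
  refine isCompact_Icc.eventually_forall_of_forall_eventually fun γ hγ => ?_
  have c1 : Continuous fun z : ℝ × ℝ => slopeSum z.2 + z.1 * slopeDiff z.2 :=
    (continuous_slopeSum.comp continuous_snd).add
      (continuous_fst.mul (continuous_slopeDiff.comp continuous_snd))
  have c2 : Continuous fun z : ℝ × ℝ => slopeSum' z.2 + z.1 * slopeDiff' z.2 :=
    (continuous_slopeSum'.comp continuous_snd).add
      (continuous_fst.mul (continuous_slopeDiff'.comp continuous_snd))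
  by_cases h : slopeSum γ + t * slopeDiff γ = 0
  · filter_upwards [c2.continuousAt.eventually_ne (ht γ hγ h)] with z hz _ using hz
  · filter_upwards [c1.continuousAt.eventually_ne (x := (t, γ)) h] with z hz hz' using
      absurd hz' hz

/-- One-dimensional Sard: a multiple zero of S + s c D is a critical point of -s S/D with value c.
The sign s = ±1 serves c and -c at once. -/
theorem ae_mul_mem_simpleRatios {s : ℝ} (hs : s ^ 2 = 1) :
    ∀ᵐ c : ℝ, s * c ∈ simpleRatios := by
  set f : ℝ → ℝ := fun γ => -s * (slopeSum γ / slopeDiff γ) with hf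
  set f' : ℝ → ℝ := fun γ =>
    -s * ((slopeSum' γ * slopeDiff γ - slopeSum γ * slopeDiff' γ) / slopeDiff γ ^ 2) with hf'
  set C : Set ℝ := {γ ∈ Ico (0 : ℝ) 1 | f' γ = 0} with hC
  have hd : ∀ γ ∈ C, HasFDerivWithinAt f
      (ContinuousLinearMap.toSpanSingleton ℝ (f' γ)) C γ := fun γ hγ =>
    (((hasDerivAt_slopeSum γ).div (hasDerivAt_slopeDiff γ)
      (slopeDiff_pos hγ.1.1 hγ.1.2).ne').const_mul (-s)).hasFDerivAt.hasFDerivWithinAt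
  have hnull : volume (f '' C) = 0 := by
    refine addHaar_image_eq_zero_of_det_fderivWithin_eq_zero volume hd fun γ hγ => ?_
    rw [hγ.2]
    simp
  refine measure_mono_null (fun c hc => ?_) hnull
  simp only [mem_compl_iff, simpleRatios, mem_ofPred_eq, not_forall, not_not] at hc
  obtain ⟨γ, hγ, h, h'⟩ := hc
  -- At γ = 1 the quotient is undefined, but there D = 0 and S > 0, so no zero occurs.
  have h1 : γ < 1 := by
    refine hγ.2.lt_of_ne ?_
    rintro rfl
    rw [slopeDiff_one, mul_zero, add_zero] at h
    exact slopeSum_one_pos.ne' h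
  have hD := (slopeDiff_pos hγ.1 h1).ne'
  have e : slopeSum γ = -(s * c) * slopeDiff γ := by linarith
  have e' : slopeSum' γ = -(s * c) * slopeDiff' γ := by linarith
  refine ⟨γ, ⟨⟨hγ.1, h1⟩, ?_⟩, ?_⟩
  · simp only [hf', e, e']
    ring
  · simp only [hf, e]
    field_simp
    linear_combination c * hs

/-- The positive `c` such that `slopeSum ± c * slopeDiff` have only simple zeros in `[0, 1]`. -/
def regularRatios : Set ℝ := {c | 0 < c ∧ c ∈ simpleRatios ∧ -c ∈ simpleRatios}

theorem one_mem_regularRatios : (1 : ℝ) ∈ regularRatios :=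
  ⟨one_pos, one_mem_simpleRatios, neg_one_mem_simpleRatios⟩

theorem isOpen_regularRatios : IsOpen regularRatios :=
  isOpen_Ioi.inter (isOpen_simpleRatios.inter (isOpen_simpleRatios.preimage continuous_neg))

theorem exists_mem_regularRatios {c : ℝ} (hc : 0 < c) {W : Set ℝ} (hW : W ∈ 𝓝 c) :
    ∃ c' ∈ W, c' ∈ regularRatios := by
  have hae : ∀ᵐ c : ℝ, c ∈ simpleRatios ∧ -c ∈ simpleRatios := by
    filter_upwards [ae_mul_mem_simpleRatios (s := 1) (by norm_num),
      ae_mul_mem_simpleRatios (s := -1) (by norm_num)] with c h1 h2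
    exact ⟨by simpa using h1, by simpa using h2⟩
  obtain ⟨c', hc', h⟩ := (Measure.dense_of_ae hae).inter_nhds_nonempty
    (inter_mem hW (Ioi_mem_nhds hc))
  exact ⟨c', h.1, h.2, hc'⟩

/-! ### Finiteness and existence of zeros in one variable -/

/-- Infinitely many zeros would accumulate in K at a zero, which a nonzero derivative makes
isolated. -/
theorem finite_zeros_of_hasDerivAt {f f' : ℝ → ℝ} {K : Set ℝ} (hK : IsCompact K)
    (hf : ∀ x, HasDerivAt f (f' x) x) (h : ∀ x ∈ K, f x = 0 → f' x ≠ 0) :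
    {x ∈ K | f x = 0}.Finite := by
  by_contra hinf
  obtain ⟨x, hx, hacc⟩ := Set.Infinite.exists_accPt_of_subset_isCompact hinf hK (sep_subset _ _)
  have hclosed : IsClosed {x | f x = 0} :=
    isClosed_eq (continuous_iff_continuousAt.2 fun x => (hf x).continuousAt) continuous_const
  have hfx : f x = 0 := by
    have := hacc.clusterPt.mono (principal_mono.2 (fun y hy => hy.2))
    exact hclosed.closure_subset (mem_closure_iff_clusterPt.2 this)
  have hne := (hf x).eventually_ne (c := 0) (h x hx hfx)
  have := accPt_iff_frequently_nhdsNE.1 hacc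
  obtain ⟨y, hy, hy'⟩ := (this.and_eventually hne).exists
  exact hy' hy.2

theorem exists_slopeSum_eq {c : ℝ} (hc : 0 < c) :
    ∃ γ ∈ Ioo (0 : ℝ) 1, slopeSum γ = c * slopeDiff γ := by
  have hcont : ContinuousOn (fun γ => slopeSum γ - c * slopeDiff γ) (Icc 0 1) :=
    (continuous_slopeSum.sub (continuous_slopeDiff.const_mul c)).continuousOn
  have h0 : slopeSum 0 - c * slopeDiff 0 < 0 := by
    have := slopeDiff_pos le_rfl zero_lt_one
    rw [slopeSum_zero]
    nlinarith
  have h1 : 0 < slopeSum 1 - c * slopeDiff 1 := by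
    rw [slopeDiff_one]
    linarith [slopeSum_one_pos]
  obtain ⟨γ, hγ, h⟩ := intermediate_value_Ioo zero_le_one hcont (mem_Ioo.2 ⟨h0, h1⟩)
  exact ⟨γ, hγ, by simpa [sub_eq_zero] using h⟩

/-! ### The coefficients as functions of the actions -/

theorem coeffA_one {e : ℝ} (he : e ≠ 0) :
    coeffA 1 e = -4 * e * (besselEntire 1 (e ^ 2) + 2 * (1 - e ^ 2) * besselEntire 2 (e ^ 2)) := by
  simp only [coeffA, Nat.cast_one, one_mul, deriv_besselJ_one, besselJ_eq]
  field_simp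
  ring

theorem coeffB_one {e : ℝ} (he : e ≠ 0) :
    coeffB 1 e =
      -8 * e * √(1 - e ^ 2) * (besselEntire 1 (e ^ 2) - besselEntire 2 (e ^ 2)) := by
  simp only [coeffB, Nat.cast_one, one_mul, deriv_besselJ_one, besselJ_eq]
  field_simp
  ring

/-- `A_1` as a function of `γ = |G| / L`. -/
noncomputable def ratioA (γ : ℝ) : ℝ :=
  -4 * √(1 - γ ^ 2) * (besselEntire 1 (1 - γ ^ 2) + 2 * γ ^ 2 * besselEntire 2 (1 - γ ^ 2))

/-- `B_1` as a function of `γ = |G| / L`. -/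
noncomputable def ratioB (γ : ℝ) : ℝ :=
  -8 * √(1 - γ ^ 2) * (γ * (besselEntire 1 (1 - γ ^ 2) - besselEntire 2 (1 - γ ^ 2)))

theorem ecc_eq {L : ℝ} (hL : 0 < L) (G : ℝ) : ecc L G = √(1 - (|G| / L) ^ 2) := by
  have h : L ^ 2 - G ^ 2 = (1 - (|G| / L) ^ 2) * L ^ 2 := by
    rw [div_pow, sq_abs]
    field_simp
  rw [ecc, h, Real.sqrt_mul' _ (sq_nonneg L), Real.sqrt_sq hL.le, mul_div_assoc, div_self hL.ne',
    mul_one]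

theorem ratio_mem {L G : ℝ} (h0 : 0 < |G|) (h1 : |G| < L) : |G| / L ∈ Ioo (0 : ℝ) 1 :=
  ⟨div_pos h0 (h0.trans h1), (div_lt_one (h0.trans h1)).2 h1⟩

theorem one_sub_sq_pos {γ : ℝ} (h : γ ∈ Ioo (0 : ℝ) 1) : 0 < 1 - γ ^ 2 := by
  nlinarith [h.1, h.2]

theorem actA_one {L G : ℝ} (h0 : 0 < |G|) (h1 : |G| < L) : actA 1 L G = ratioA (|G| / L) := by
  have hx := one_sub_sq_pos (ratio_mem h0 h1)
  rw [actA, ecc_eq (h0.trans h1), coeffA_one (Real.sqrt_pos.2 hx).ne', Real.sq_sqrt hx.le, ratioA,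
    sub_sub_cancel]

theorem actB_one {L G : ℝ} (h0 : 0 < |G|) (h1 : |G| < L) : actB 1 L G = ratioB (|G| / L) := by
  have hγ := ratio_mem h0 h1
  have hx := one_sub_sq_pos hγ
  rw [actB, ecc_eq (h0.trans h1), coeffB_one (Real.sqrt_pos.2 hx).ne', Real.sq_sqrt hx.le, ratioB,
    sub_sub_cancel, Real.sqrt_sq hγ.1.le]
  ring

theorem hasDerivAt_sqrt_one_sub_sq {γ : ℝ} (h : γ ∈ Ioo (0 : ℝ) 1) :
    HasDerivAt (fun y : ℝ => √(1 - y ^ 2)) (-γ / √(1 - γ ^ 2)) γ := by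
  refine ((hasDerivAt_one_sub_sq γ).sqrt (one_sub_sq_pos h).ne').congr_deriv ?_
  ring

theorem hasDerivAt_ratioA {γ : ℝ} (h : γ ∈ Ioo (0 : ℝ) 1) :
    HasDerivAt ratioA (4 / √(1 - γ ^ 2) * (γ * slopeA (1 - γ ^ 2))) γ := by
  have hx := one_sub_sq_pos h
  have hs := Real.sqrt_pos.2 hx
  have d1 := (hasDerivAt_besselEntire 1 (1 - γ ^ 2)).comp γ (hasDerivAt_one_sub_sq γ)
  have d2 := (hasDerivAt_besselEntire 2 (1 - γ ^ 2)).comp γ (hasDerivAt_one_sub_sq γ)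
  have hd := ((hasDerivAt_sqrt_one_sub_sq h).const_mul (-4)).mul
    (d1.add (((hasDerivAt_pow 2 γ).const_mul 2).mul d2))
  refine hd.congr_deriv ?_
  have hsq := Real.sq_sqrt hx.le
  have r := besselEntire_one_eq (1 - γ ^ 2)
  simp only [slopeA, Function.comp_apply, Nat.cast_ofNat, Nat.add_one_sub_one, Pi.mul_apply,
    Pi.add_apply, pow_one, Nat.reduceAdd]
  field_simp
  rw [hsq, r]
  ring

theorem hasDerivAt_ratioB {γ : ℝ} (h : γ ∈ Ioo (0 : ℝ) 1) :
    HasDerivAt ratioB (4 / √(1 - γ ^ 2) * (-2 * slopeB (1 - γ ^ 2))) γ := by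
  have hx := one_sub_sq_pos h
  have hs := Real.sqrt_pos.2 hx
  have d1 := (hasDerivAt_besselEntire 1 (1 - γ ^ 2)).comp γ (hasDerivAt_one_sub_sq γ)
  have d2 := (hasDerivAt_besselEntire 2 (1 - γ ^ 2)).comp γ (hasDerivAt_one_sub_sq γ)
  have hd := ((hasDerivAt_sqrt_one_sub_sq h).const_mul (-8)).mul
    ((hasDerivAt_id γ).mul (d1.sub d2))
  refine hd.congr_deriv ?_
  have hsq := Real.sq_sqrt hx.le
  have r := besselEntire_one_eq (1 - γ ^ 2)
  simp only [slopeB, Function.comp_apply, Pi.mul_apply, Pi.sub_apply, id, Nat.reduceAdd]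
  field_simp
  rw [hsq, r]
  ring

theorem ratioA_add_ratioB_neg {γ : ℝ} (h : γ ∈ Ioo (0 : ℝ) 1) : ratioA γ + ratioB γ < 0 := by
  have hs := Real.sqrt_pos.2 (one_sub_sq_pos h)
  have hx := one_sub_sq_mem ⟨h.1.le, h.2.le⟩
  obtain ⟨v1, v2⟩ := besselEntire_one_mem hx
  obtain ⟨w1, w2⟩ := besselEntire_two_mem hx
  have h1 : 0 < γ * (besselEntire 1 (1 - γ ^ 2) - besselEntire 2 (1 - γ ^ 2)) :=
    mul_pos h.1 (by linarith)
  have h2 : 0 ≤ 2 * γ ^ 2 * besselEntire 2 (1 - γ ^ 2) := mul_nonneg (by positivity) (by linarith)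
  have h3 : ratioA γ + ratioB γ = -(4 * √(1 - γ ^ 2) * (besselEntire 1 (1 - γ ^ 2)
      + 2 * γ ^ 2 * besselEntire 2 (1 - γ ^ 2)
      + 2 * (γ * (besselEntire 1 (1 - γ ^ 2) - besselEntire 2 (1 - γ ^ 2))))) := by
    rw [ratioA, ratioB]
    ring
  rw [h3, neg_lt_zero]
  exact mul_pos (by positivity) (by linarith)

/-- The two terms cancel at γ = 1; the recurrence exposes the factor 1 - γ, whose cofactor is at
least 1/6 - 1/36. -/
theorem ratioA_sub_ratioB_neg {γ : ℝ} (h : γ ∈ Ioo (0 : ℝ) 1) : ratioA γ - ratioB γ < 0 := by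
  have hs := Real.sqrt_pos.2 (one_sub_sq_pos h)
  have hx := one_sub_sq_mem ⟨h.1.le, h.2.le⟩
  obtain ⟨w1, w2⟩ := besselEntire_two_mem hx
  obtain ⟨z1, z2⟩ := besselEntire_three_mem hx
  have h3 : ratioA γ - ratioB γ = -(4 * √(1 - γ ^ 2) * ((1 - γ) *
      (2 * (2 - γ) * besselEntire 2 (1 - γ ^ 2)
        + (2 * γ ^ 2 + γ - 1) * besselEntire 3 (1 - γ ^ 2)))) := by
    rw [ratioA, ratioB, besselEntire_one_eq]
    ring
  obtain ⟨h0, h1⟩ := h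
  rw [h3, neg_lt_zero]
  refine mul_pos (by positivity) (mul_pos (by linarith) ?_)
  have e1 : 2 * 1 * (1 / 12) ≤ 2 * (2 - γ) * besselEntire 2 (1 - γ ^ 2) :=
    mul_le_mul (by linarith) w1 (by norm_num) (by linarith)
  have e2 : 0 ≤ (2 * γ ^ 2 + γ) * besselEntire 3 (1 - γ ^ 2) :=
    mul_nonneg (by positivity) (by linarith)
  linarith

theorem hasDerivAt_abs_div {L G : ℝ} (h0 : 0 < |G|) :
    HasDerivAt (fun G' : ℝ => |G'| / L) (G / |G| / L) G := by
  refine ((hasDerivAt_abs (abs_pos.1 h0)).div_const L).congr_deriv ?_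
  rcases lt_or_gt_of_ne (abs_pos.1 h0) with h | h
  · simp [h, abs_of_neg h, h.ne]
  · simp [h, abs_of_pos h, h.ne']

theorem eventually_abs_mem {L G : ℝ} (h0 : 0 < |G|) (h1 : |G| < L) :
    ∀ᶠ G' in 𝓝 G, 0 < |G'| ∧ |G'| < L :=
  (continuous_abs.continuousAt.eventually_const_lt h0).and
    (continuous_abs.continuousAt.eventually_lt_const h1)

theorem hasDerivAt_actA {L G : ℝ} (h0 : 0 < |G|) (h1 : |G| < L) :
    HasDerivAt (fun G' => actA 1 L G')
      (4 / √(1 - (|G| / L) ^ 2) * (|G| / L * slopeA (1 - (|G| / L) ^ 2)) * (G / |G| / L)) G := by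
  refine ((hasDerivAt_ratioA (ratio_mem h0 h1)).comp G
    (hasDerivAt_abs_div h0)).congr_of_eventuallyEq ?_
  filter_upwards [eventually_abs_mem h0 h1] with G' h using actA_one h.1 h.2

theorem hasDerivAt_actB {L G : ℝ} (h0 : 0 < |G|) (h1 : |G| < L) :
    HasDerivAt (fun G' => actB 1 L G')
      (4 / √(1 - (|G| / L) ^ 2) * (-2 * slopeB (1 - (|G| / L) ^ 2)) * (G / |G| / L)) G := by
  refine ((hasDerivAt_ratioB (ratio_mem h0 h1)).comp G
    (hasDerivAt_abs_div h0)).congr_of_eventuallyEq ?_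
  filter_upwards [eventually_abs_mem h0 h1] with G' h using actB_one h.1 h.2

/-- The common factor of `∂(A_1 + B_1)/∂G` and `∂(A_1 - B_1)/∂G`. -/
noncomputable def slopeFactor (L G : ℝ) : ℝ := 4 / √(1 - (|G| / L) ^ 2) * (G / |G| / L)

theorem slopeFactor_ne_zero {L G : ℝ} (h0 : 0 < |G|) (h1 : |G| < L) : slopeFactor L G ≠ 0 := by
  have hs := Real.sqrt_pos.2 (one_sub_sq_pos (ratio_mem h0 h1))
  have hL := h0.trans h1
  have hG := abs_pos.1 h0
  unfold slopeFactor
  positivity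

theorem differentiableAt_slopeFactor {L G : ℝ} (h0 : 0 < |G|) (h1 : |G| < L) :
    DifferentiableAt ℝ (slopeFactor L) G := by
  have hs := Real.sqrt_pos.2 (one_sub_sq_pos (ratio_mem h0 h1))
  have d1 : DifferentiableAt ℝ (fun G' : ℝ => √(1 - (|G'| / L) ^ 2)) G :=
    (HasDerivAt.comp (h₂ := fun y : ℝ => √(1 - y ^ 2)) (h := fun G' : ℝ => |G'| / L) G
      (hasDerivAt_sqrt_one_sub_sq (ratio_mem h0 h1)) (hasDerivAt_abs_div (L := L) h0)).differentiableAt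
  have d2 : DifferentiableAt ℝ (fun G' : ℝ => G' / |G'|) G :=
    differentiableAt_id.div (hasDerivAt_abs (abs_pos.1 h0)).differentiableAt h0.ne'
  exact ((differentiableAt_const 4).div d1 hs.ne').mul (d2.div_const L)

theorem actA_G_add_actB_G {L G : ℝ} (h0 : 0 < |G|) (h1 : |G| < L) :
    actA_G 1 L G + actB_G 1 L G = slopeFactor L G * slopeSum (|G| / L) := by
  rw [actA_G, actB_G, (hasDerivAt_actA h0 h1).deriv, (hasDerivAt_actB h0 h1).deriv, slopeFactor,
    slopeSum]
  ring

theorem actA_G_sub_actB_G {L G : ℝ} (h0 : 0 < |G|) (h1 : |G| < L) :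
    actA_G 1 L G - actB_G 1 L G = slopeFactor L G * slopeDiff (|G| / L) := by
  rw [actA_G, actB_G, (hasDerivAt_actA h0 h1).deriv, (hasDerivAt_actB h0 h1).deriv, slopeFactor,
    slopeDiff]
  ring

theorem hasDerivAt_actA_G_add_actB_G {L G : ℝ} (h0 : 0 < |G|) (h1 : |G| < L) :
    HasDerivAt (fun G' => actA_G 1 L G' + actB_G 1 L G')
      (deriv (slopeFactor L) G * slopeSum (|G| / L) +
        slopeFactor L G * (slopeSum' (|G| / L) * (G / |G| / L))) G := by
  refine ((differentiableAt_slopeFactor h0 h1).hasDerivAt.mul ((hasDerivAt_slopeSum _).comp G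
    (hasDerivAt_abs_div h0))).congr_of_eventuallyEq ?_
  filter_upwards [eventually_abs_mem h0 h1] with G' h using actA_G_add_actB_G h.1 h.2

theorem hasDerivAt_actA_G_sub_actB_G {L G : ℝ} (h0 : 0 < |G|) (h1 : |G| < L) :
    HasDerivAt (fun G' => actA_G 1 L G' - actB_G 1 L G')
      (deriv (slopeFactor L) G * slopeDiff (|G| / L) +
        slopeFactor L G * (slopeDiff' (|G| / L) * (G / |G| / L))) G := by
  refine ((differentiableAt_slopeFactor h0 h1).hasDerivAt.mul ((hasDerivAt_slopeDiff _).comp G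
    (hasDerivAt_abs_div h0))).congr_of_eventuallyEq ?_
  filter_upwards [eventually_abs_mem h0 h1] with G' h using actA_G_sub_actB_G h.1 h.2

/-! ### The zeros of the bifurcation system -/

theorem isSimpleZero_of_injective {F : ℝ × ℝ × ℝ → ℝ × ℝ × ℝ} {z : ℝ × ℝ × ℝ}
    {D : (ℝ × ℝ × ℝ) →L[ℝ] (ℝ × ℝ × ℝ)} (h0 : F z = 0) (hD : HasFDerivAt F D z)
    (hinj : ∀ h, D h = 0 → h = 0) : IsSimpleZero F z := by
  have hinj' : Function.Injective (D : (ℝ × ℝ × ℝ) →ₗ[ℝ] (ℝ × ℝ × ℝ)) :=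
    (injective_iff_map_eq_zero _).2 hinj
  refine ⟨h0, (LinearEquiv.ofInjectiveEndo _ hinj').toContinuousLinearEquiv, ?_⟩
  have e : ((LinearEquiv.ofInjectiveEndo _ hinj').toContinuousLinearEquiv :
      (ℝ × ℝ × ℝ) →L[ℝ] (ℝ × ℝ × ℝ)) = D := by
    refine ContinuousLinearMap.ext fun h => ?_
    simp
  rwa [e]

/-- A simplicity criterion for systems of the shape of the bifurcation system. -/
theorem isSimpleZero_trig {p q r t : ℝ → ℝ} {p' q' r' t' τ σ G l g : ℝ}
    (hp : HasDerivAt p p' G) (hq : HasDerivAt q q' G) (hr : HasDerivAt r r' G)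
    (ht : HasDerivAt t t' G) (hp0 : p G ≠ 0) (hq0 : q G ≠ 0)
    (hφ : Real.cos (2 * g + l + τ) = 0) (hψ : Real.cos (2 * g - l + σ) = 0)
    (h3 : r G * Real.sin (2 * g + l + τ) + t G * Real.sin (2 * g - l + σ) = 0)
    (h4 : r' * Real.sin (2 * g + l + τ) + t' * Real.sin (2 * g - l + σ) ≠ 0) :
    IsSimpleZero (fun z : ℝ × ℝ × ℝ =>
      (p z.1 * Real.cos (2 * z.2.2 + z.2.1 + τ), q z.1 * Real.cos (2 * z.2.2 - z.2.1 + σ),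
        r z.1 * Real.sin (2 * z.2.2 + z.2.1 + τ) + t z.1 * Real.sin (2 * z.2.2 - z.2.1 + σ)))
      (G, l, g) := by
  have hsφ : Real.sin (2 * g + l + τ) ≠ 0 := fun h => by
    simpa [h, hφ] using Real.sin_sq_add_cos_sq (2 * g + l + τ)
  have hsψ : Real.sin (2 * g - l + σ) ≠ 0 := fun h => by
    simpa [h, hψ] using Real.sin_sq_add_cos_sq (2 * g - l + σ)
  have d1 : HasFDerivAt (fun z : ℝ × ℝ × ℝ => z.1) (ContinuousLinearMap.fst ℝ ℝ (ℝ × ℝ))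
    (G, l, g) := hasFDerivAt_fst
  have d2 : HasFDerivAt (fun z : ℝ × ℝ × ℝ => z.2.1)
      ((ContinuousLinearMap.fst ℝ ℝ ℝ).comp (ContinuousLinearMap.snd ℝ ℝ (ℝ × ℝ))) (G, l, g) :=
    hasFDerivAt_fst.comp _ hasFDerivAt_snd
  have d3 : HasFDerivAt (fun z : ℝ × ℝ × ℝ => z.2.2)
      ((ContinuousLinearMap.snd ℝ ℝ ℝ).comp (ContinuousLinearMap.snd ℝ ℝ (ℝ × ℝ))) (G, l, g) :=
    hasFDerivAt_snd.comp _ hasFDerivAt_snd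
  have dφ := ((d3.const_mul 2).add d2).add_const τ
  have dψ := ((d3.const_mul 2).sub d2).add_const σ
  have D1 := (hp.comp_hasFDerivAt (G, l, g) d1).mul dφ.cos
  have D2 := (hq.comp_hasFDerivAt (G, l, g) d1).mul dψ.cos
  have D3 := ((hr.comp_hasFDerivAt (G, l, g) d1).mul dφ.sin).add
    ((ht.comp_hasFDerivAt (G, l, g) d1).mul dψ.sin)
  refine isSimpleZero_of_injective (by simp [hφ, hψ, h3]) (D1.prodMk (D2.prodMk D3)) ?_
  rintro ⟨x, y, u⟩ h
  -- Since both cosines vanish, the first two rows of the Jacobian involve only (ℓ, g) and the third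
  -- only G, with the entry in `h4`.
  simp [hφ, hψ, hq0, hsψ] at h
  obtain ⟨e1, e2, e3⟩ := h
  have hx : x = 0 := by
    have : (r' * Real.sin (2 * g + l + τ) + t' * Real.sin (2 * g - l + σ)) * x = 0 := by
      linear_combination e3
    exact (mul_eq_zero.1 this).resolve_left h4
  have e1' : 2 * u + y = 0 := by
    have : p G * Real.sin (2 * g + l + τ) * (2 * u + y) = 0 := by linear_combination -e1
    exact (mul_eq_zero.1 this).resolve_left (mul_ne_zero hp0 hsφ)
  have hy : y = 0 := by linarith
  have hu : u = 0 := by linarith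
  simp [hx, hy, hu]

theorem finite_cos_zeros (a b : ℝ) : {x ∈ Icc a b | Real.cos x = 0}.Finite :=
  finite_zeros_of_hasDerivAt isCompact_Icc Real.hasDerivAt_cos fun x _ h h' => by
    simpa [h, neg_eq_zero.1 h'] using Real.sin_sq_add_cos_sq x

theorem sin_sq_eq_one_of_cos {x : ℝ} (h : Real.cos x = 0) : Real.sin x ^ 2 = 1 := by
  simpa [h] using Real.sin_sq_add_cos_sq x

theorem bifSystem_eq_zero_iff {L α β ρ G l g : ℝ} (hE : 0 < ampE α β ρ) (hF : 0 < ampF α β ρ)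
    (h0 : 0 < |G|) (h1 : |G| < L) :
    bifSystem 1 L α β ρ (G, l, g) = 0 ↔
      Real.cos (2 * g + l + phaseF α β ρ) = 0 ∧ Real.cos (2 * g - l + phaseE α β ρ) = 0 ∧
      slopeSum (|G| / L) * ampF α β ρ * Real.sin (2 * g + l + phaseF α β ρ) +
        slopeDiff (|G| / L) * ampE α β ρ * Real.sin (2 * g - l + phaseE α β ρ) = 0 := by
  have hs := ratioA_add_ratioB_neg (ratio_mem h0 h1)
  have hd := ratioA_sub_ratioB_neg (ratio_mem h0 h1)
  have hk := slopeFactor_ne_zero h0 h1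
  simp only [bifSystem, Nat.cast_one, one_mul, Prod.mk_eq_zero, actA_one h0 h1, actB_one h0 h1,
    actA_G_add_actB_G h0 h1, actA_G_sub_actB_G h0 h1, mul_eq_zero, hE.ne', hF.ne', hs.ne, hd.ne,
    false_or]
  rw [← mul_eq_zero_iff_left hk (b := slopeSum (|G| / L) * _ * _ + _)]
  ring_nf

/-- Multiplying by s = ±1 turns s into s² = 1. It is applied both to the slopes and to their
derivatives. -/
theorem sin_relation {s s' E F c S D : ℝ} (hs : s ^ 2 = 1) (hF : F ≠ 0) (hc : E = c * F)
    (h : S * F * s + D * E * s' = 0) : S + s * s' * c * D = 0 := by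
  have : F * (S + s * s' * c * D) = 0 := by
    rw [hc] at h
    linear_combination s * h - S * F * hs
  exact (mul_eq_zero.1 this).resolve_left hF

theorem mul_mem_simpleRatios {s s' c : ℝ} (hs : s ^ 2 = 1) (hs' : s' ^ 2 = 1)
    (hc : c ∈ regularRatios) : s * s' * c ∈ simpleRatios := by
  have h : (s * s') ^ 2 = 1 := by rw [mul_pow, hs, hs', one_mul]
  rcases sq_eq_one_iff.1 h with h | h
  · rw [h, one_mul]; exact hc.2.1
  · rw [h, neg_one_mul]; exact hc.2.2

theorem isSimpleZero_bifSystem {L α β ρ c : ℝ} (hF : 0 < ampF α β ρ)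
    (hc : c ∈ regularRatios) (hEF : ampE α β ρ = c * ampF α β ρ) {z : ℝ × ℝ × ℝ}
    (hz : z ∈ bifZeros 1 L α β ρ) : IsSimpleZero (bifSystem 1 L α β ρ) z := by
  obtain ⟨G, l, g⟩ := z
  obtain ⟨⟨h0, h1, -, -⟩, hz⟩ := hz
  simp only at h0 h1
  have hE : 0 < ampE α β ρ := hEF ▸ mul_pos hc.1 hF
  have hγ := ratio_mem h0 h1
  have hk := slopeFactor_ne_zero h0 h1
  obtain ⟨hφ, hψ, h3⟩ := (bifSystem_eq_zero_iff hE hF h0 h1).1 hz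
  have hsφ := sin_sq_eq_one_of_cos hφ
  have hsψ := sin_sq_eq_one_of_cos hψ
  have key := mul_mem_simpleRatios hsφ hsψ hc _ ⟨hγ.1.le, hγ.2.le⟩ (sin_relation hsφ hF.ne' hEF h3)
  have e : bifSystem 1 L α β ρ = fun z : ℝ × ℝ × ℝ =>
      (ampF α β ρ * (actA 1 L z.1 + actB 1 L z.1) * Real.cos (2 * z.2.2 + z.2.1 + phaseF α β ρ),
       ampE α β ρ * (actA 1 L z.1 - actB 1 L z.1) * Real.cos (2 * z.2.2 - z.2.1 + phaseE α β ρ),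
       (actA_G 1 L z.1 + actB_G 1 L z.1) * ampF α β ρ *
          Real.sin (2 * z.2.2 + z.2.1 + phaseF α β ρ) +
       (actA_G 1 L z.1 - actB_G 1 L z.1) * ampE α β ρ *
          Real.sin (2 * z.2.2 - z.2.1 + phaseE α β ρ)) := by
    funext z
    simp [bifSystem]
  rw [e]
  refine isSimpleZero_trig
    (p := fun G' => ampF α β ρ * (actA 1 L G' + actB 1 L G'))
    (q := fun G' => ampE α β ρ * (actA 1 L G' - actB 1 L G'))
    (r := fun G' => (actA_G 1 L G' + actB_G 1 L G') * ampF α β ρ)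
    (t := fun G' => (actA_G 1 L G' - actB_G 1 L G') * ampE α β ρ)
    (((hasDerivAt_actA h0 h1).add (hasDerivAt_actB h0 h1)).const_mul _)
    (((hasDerivAt_actA h0 h1).sub (hasDerivAt_actB h0 h1)).const_mul _)
    ((hasDerivAt_actA_G_add_actB_G h0 h1).mul_const _)
    ((hasDerivAt_actA_G_sub_actB_G h0 h1).mul_const _) ?_ ?_ hφ hψ ?_ ?_
  · rw [actA_one h0 h1, actB_one h0 h1]
    exact mul_ne_zero hF.ne' (ratioA_add_ratioB_neg hγ).ne
  · rw [actA_one h0 h1, actB_one h0 h1]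
    exact mul_ne_zero hE.ne' (ratioA_sub_ratioB_neg hγ).ne
  · simp only [actA_G_add_actB_G h0 h1, actA_G_sub_actB_G h0 h1]
    linear_combination slopeFactor L G * h3
  · intro h
    have hL := h0.trans h1
    have hη : G / |G| / L ≠ 0 := by
      have := abs_pos.1 h0
      positivity
    have h' : slopeFactor L G * (G / |G| / L) * (slopeSum' (|G| / L) * ampF α β ρ *
        Real.sin (2 * g + l + phaseF α β ρ) + slopeDiff' (|G| / L) * ampE α β ρ *
        Real.sin (2 * g - l + phaseE α β ρ)) = 0 := by
      -- The product-rule term containing the derivative of the common factor is a multiple of the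
      -- third equation, so it drops out.
      linear_combination h - deriv (slopeFactor L) G * h3
    exact key (sin_relation hsφ hF.ne' hEF ((mul_eq_zero.1 h').resolve_left (mul_ne_zero hk hη)))

theorem finite_bifZeros {L α β ρ c : ℝ} (hF : 0 < ampF α β ρ)
    (hc : c ∈ regularRatios) (hEF : ampE α β ρ = c * ampF α β ρ) :
    (bifZeros 1 L α β ρ).Finite := by
  have hE : 0 < ampE α β ρ := hEF ▸ mul_pos hc.1 hF
  have hZ (t : ℝ) (ht : t ∈ simpleRatios) :
      {γ ∈ Icc (0 : ℝ) 1 | slopeSum γ + t * slopeDiff γ = 0}.Finite :=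
    finite_zeros_of_hasDerivAt isCompact_Icc
      (fun γ => (hasDerivAt_slopeSum γ).add ((hasDerivAt_slopeDiff γ).const_mul t)) ht
  set τ := phaseF α β ρ with hτ
  set σ := phaseE α β ρ with hσ
  -- A zero is recovered from γ, the sign of G and the two phases. For ℓ, g in [0, 2π), 2g + ℓ lies
  -- in [0, 6π) and 2g - ℓ in (-2π, 4π), so each datum ranges over a finite set.
  have hfin : (({γ ∈ Icc (0 : ℝ) 1 | slopeSum γ + c * slopeDiff γ = 0} ∪
      {γ ∈ Icc (0 : ℝ) 1 | slopeSum γ + -c * slopeDiff γ = 0}) ×ˢ (({1, -1} : Set ℝ) ×ˢ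
      ({x ∈ Icc τ (6 * Real.pi + τ) | Real.cos x = 0} ×ˢ
      {x ∈ Icc (-(2 * Real.pi) + σ) (4 * Real.pi + σ) | Real.cos x = 0}))).Finite :=
    ((hZ c hc.2.1).union (hZ (-c) hc.2.2)).prod ((toFinite _).prod
      ((finite_cos_zeros _ _).prod (finite_cos_zeros _ _)))
  refine (hfin.image fun w : ℝ × ℝ × ℝ × ℝ => (w.2.1 * (L * w.1),
    ((w.2.2.1 - τ) - (w.2.2.2 - σ)) / 2, ((w.2.2.1 - τ) + (w.2.2.2 - σ)) / 4)).subset ?_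
  rintro ⟨G, l, g⟩ ⟨⟨h0, h1, hl, hg⟩, hz⟩
  simp only at h0 h1 hl hg
  have hγ := ratio_mem h0 h1
  have hL := h0.trans h1
  obtain ⟨hφ, hψ, h3⟩ := (bifSystem_eq_zero_iff hE hF h0 h1).1 hz
  have hsφ := sin_sq_eq_one_of_cos hφ
  have hsψ := sin_sq_eq_one_of_cos hψ
  have h3' := sin_relation hsφ hF.ne' hEF h3
  have hss : (Real.sin (2 * g + l + τ) * Real.sin (2 * g - l + σ)) ^ 2 = 1 := by
    rw [mul_pow, hsφ, hsψ, one_mul]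
  refine ⟨(|G| / L, G / |G|, 2 * g + l + τ, 2 * g - l + σ), ⟨?_, ?_, ⟨⟨?_, ?_⟩, hφ⟩,
    ⟨⟨?_, ?_⟩, hψ⟩⟩, ?_⟩
  · rcases sq_eq_one_iff.1 hss with h | h
    · rw [h, one_mul] at h3'
      exact Or.inl ⟨⟨hγ.1.le, hγ.2.le⟩, h3'⟩
    · rw [h, neg_one_mul] at h3'
      exact Or.inr ⟨⟨hγ.1.le, hγ.2.le⟩, h3'⟩
  · rcases lt_or_gt_of_ne (abs_pos.1 h0) with h | h
    · right
      simp [abs_of_neg h, h.ne]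
    · left
      simp [abs_of_pos h, h.ne']
  · simp only; linarith [hl.1, hg.1]
  · simp only; linarith [hl.2, hg.2]
  · simp only; linarith [hl.2, hg.1]
  · simp only; linarith [hl.1, hg.2]
  · simp only [Prod.mk.injEq]
    refine ⟨?_, by ring, by ring⟩
    field_simp

theorem nonempty_bifZeros {L α β ρ : ℝ} (hL : 0 < L) (hE : 0 < ampE α β ρ)
    (hF : 0 < ampF α β ρ) : (bifZeros 1 L α β ρ).Nonempty := by
  obtain ⟨γ, hγ, h⟩ := exists_slopeSum_eq (div_pos hE hF)
  have h2π : 0 < 2 * Real.pi := Real.two_pi_pos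
  set τ := phaseF α β ρ with hτ
  set σ := phaseE α β ρ with hσ
  -- Chosen so that the two phases are π/2 and -π/2: the sines are 1 and -1, and the third equation
  -- becomes Sℱ = Dℰ.
  set l₀ : ℝ := ((Real.pi / 2 - τ) - (-(Real.pi / 2) - σ)) / 2 with hl₀
  set g₀ : ℝ := ((Real.pi / 2 - τ) + (-(Real.pi / 2) - σ)) / 4 with hg₀
  set i := toIcoDiv h2π 0 l₀ with hi
  set j := toIcoDiv h2π 0 g₀ with hj
  have el : toIcoMod h2π 0 l₀ = l₀ - i * (2 * Real.pi) := by rw [toIcoMod, zsmul_eq_mul]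
  have eg : toIcoMod h2π 0 g₀ = g₀ - j * (2 * Real.pi) := by rw [toIcoMod, zsmul_eq_mul]
  have ml := toIcoMod_mem_Ico h2π 0 l₀
  have mg := toIcoMod_mem_Ico h2π 0 g₀
  rw [zero_add] at ml mg
  have hG : |L * γ| = L * γ := abs_of_pos (mul_pos hL hγ.1)
  have h0 : 0 < |L * γ| := by rw [hG]; exact mul_pos hL hγ.1
  have h1 : |L * γ| < L := by rw [hG]; nlinarith [hγ.2]
  -- Reducing ℓ and g modulo 2π changes both phases by integer multiples of 2π.
  have eφ : 2 * toIcoMod h2π 0 g₀ + toIcoMod h2π 0 l₀ + τ =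
      Real.pi / 2 - ((2 * j + i : ℤ) : ℝ) * (2 * Real.pi) := by
    rw [el, eg, hl₀, hg₀]
    push_cast
    ring
  have eψ : 2 * toIcoMod h2π 0 g₀ - toIcoMod h2π 0 l₀ + σ =
      -(Real.pi / 2) - ((2 * j - i : ℤ) : ℝ) * (2 * Real.pi) := by
    rw [el, eg, hl₀, hg₀]
    push_cast
    ring
  refine ⟨(L * γ, toIcoMod h2π 0 l₀, toIcoMod h2π 0 g₀), ⟨h0, h1, ml, mg⟩,
    (bifSystem_eq_zero_iff hE hF h0 h1).2 ⟨?_, ?_, ?_⟩⟩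
  · rw [← hτ, eφ, Real.cos_sub_int_mul_two_pi, Real.cos_pi_div_two]
  · rw [← hσ, eψ, Real.cos_sub_int_mul_two_pi, Real.cos_neg, Real.cos_pi_div_two]
  · rw [← hτ, ← hσ, eφ, eψ, Real.sin_sub_int_mul_two_pi, Real.sin_sub_int_mul_two_pi, Real.sin_neg,
      Real.sin_pi_div_two, hG, mul_div_cancel_left₀ _ hL.ne', h]
    field_simp
    ring

theorem hasFiniteSimpleZeros_of_mem {L α β ρ : ℝ} (hL : 0 < L) (hF : 0 < ampF α β ρ)
    (hc : ampE α β ρ / ampF α β ρ ∈ regularRatios) : HasFiniteSimpleZeros 1 L α β ρ := by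
  have hEF : ampE α β ρ = ampE α β ρ / ampF α β ρ * ampF α β ρ := (div_mul_cancel₀ _ hF.ne').symm
  have hE : 0 < ampE α β ρ := hEF ▸ mul_pos hc.1 hF
  exact ⟨nonempty_bifZeros hL hE hF, finite_bifZeros hF hc hEF,
    fun z hz => isSimpleZero_bifSystem hF hc hEF hz⟩

/-! ### Generic wave parameters -/

/-- The wave parameters whose amplitudes are nonzero with regular quotient. -/
def genericWaves : Set (ℝ × ℝ × ℝ) :=
  {p | 0 < ampF p.1 p.2.1 p.2.2 ∧ ampE p.1 p.2.1 p.2.2 / ampF p.1 p.2.1 p.2.2 ∈ regularRatios}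

theorem isOpen_genericWaves : IsOpen genericWaves := by
  have cE : Continuous fun p : ℝ × ℝ × ℝ => ampE p.1 p.2.1 p.2.2 := by
    unfold ampE
    fun_prop
  have cF : Continuous fun p : ℝ × ℝ × ℝ => ampF p.1 p.2.1 p.2.2 := by
    unfold ampF
    fun_prop
  rw [isOpen_iff_mem_nhds]
  rintro p ⟨hF, hc⟩
  exact inter_mem (cF.continuousAt.eventually_const_lt hF)
    ((cE.continuousAt.div cF.continuousAt hF.ne').preimage_mem_nhds
      (isOpen_regularRatios.mem_nhds hc))

theorem dense_setOf_generic :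
    Dense {p : ℝ × ℝ × ℝ | p.1 ≠ 0 ∧ p.2.1 ≠ 0 ∧ Real.cos p.2.2 ≠ 0} := by
  have h0 : Dense {x : ℝ | x ≠ 0} := dense_compl_singleton 0
  have hcos : Dense {x : ℝ | Real.cos x ≠ 0} := by
    intro x
    by_cases hx : Real.cos x = 0
    · have hs : -Real.sin x ≠ 0 := fun h => by
        simpa [hx, neg_eq_zero.1 h] using Real.sin_sq_add_cos_sq x
      exact mem_closure_iff_frequently.2
        (((Real.hasDerivAt_cos x).eventually_ne (c := 0) hs).frequently.filter_mono
          nhdsWithin_le_nhds)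
    · exact subset_closure hx
  exact h0.prod (h0.prod hcos)

/-- Where α, β and cos ρ are nonzero, ρ ↦ ℰ/ℱ has nonzero derivative, so it maps neighbourhoods onto
neighbourhoods; an arbitrarily small change of ρ alone therefore reaches a regular ratio. -/
theorem dense_genericWaves : Dense genericWaves := by
  refine dense_iff_inter_open.2 fun W hW hne => ?_
  obtain ⟨⟨α, β, ρ⟩, hp, hα, hβ, hρ⟩ := dense_setOf_generic.inter_open_nonempty W hW hne
  simp only at hα hβ hρ
  have hcos2 : 0 < Real.cos ρ ^ 2 := by positivity
  have hβ2 : 0 < β ^ 2 := by positivity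
  have hsc := Real.sin_sq_add_cos_sq ρ
  -- The radicands equal (α ± β sin ρ)² + β² cos² ρ.
  have hPE : 0 < α ^ 2 + β ^ 2 + 2 * α * β * Real.sin ρ := by
    nlinarith [sq_nonneg (α + β * Real.sin ρ), mul_pos hβ2 hcos2]
  have hPF : 0 < α ^ 2 + β ^ 2 - 2 * α * β * Real.sin ρ := by
    nlinarith [sq_nonneg (α - β * Real.sin ρ), mul_pos hβ2 hcos2]
  have hE : 0 < ampE α β ρ := Real.sqrt_pos.2 hPE
  have hF : 0 < ampF α β ρ := Real.sqrt_pos.2 hPF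
  have ds : HasStrictDerivAt (fun r => 2 * α * β * Real.sin r) (2 * α * β * Real.cos ρ) ρ :=
    (Real.hasStrictDerivAt_sin ρ).const_mul _
  have dE := (ds.const_add (α ^ 2 + β ^ 2)).sqrt hPE.ne'
  have dF := (ds.const_sub (α ^ 2 + β ^ 2)).sqrt hPF.ne'
  have dq := dE.div dF hF.ne'
  have hmap := dq.map_nhds_eq (by
    have hk : 2 * α * β * Real.cos ρ ≠ 0 := by simp [hα, hβ, hρ]
    -- ℰ² and ℱ² have opposite ρ-derivatives, so the two terms of the quotient rule add up instead
    -- of cancelling.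
    have hpos : 0 < 1 / (2 * ampE α β ρ) * ampF α β ρ + ampE α β ρ / (2 * ampF α β ρ) := by
      positivity
    refine div_ne_zero ?_ (pow_ne_zero 2 hF.ne')
    convert mul_ne_zero hk hpos.ne' using 1
    simp only [ampE, ampF]
    ring)
  have hcW : ContinuousAt (fun r : ℝ => (α, β, r)) ρ := by fun_prop
  have hWρ : {r : ℝ | (α, β, r) ∈ W ∧ 0 < ampF α β r} ∈ 𝓝 ρ := by
    have cF : Continuous fun r => ampF α β r := by
      unfold ampF
      fun_prop
    exact inter_mem (hcW.preimage_mem_nhds (hW.mem_nhds hp))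
      (cF.continuousAt.eventually_const_lt hF)
  have himg := image_mem_map (m := fun r => ampE α β r / ampF α β r) hWρ
  obtain ⟨c, ⟨r, ⟨hrW, hrF⟩, rfl⟩, hc⟩ := exists_mem_regularRatios (div_pos hE hF)
    (hmap ▸ himg)
  exact ⟨(α, β, r), hrW, hrF, hc⟩

end KeplerWave

theorem mainTheorem1 (L : ℝ) (hL : 0 < L) :
    (∃ U : Set (ℝ × ℝ × ℝ), IsOpen U ∧ Dense U ∧
      ∀ α β ρ : ℝ, (α, β, ρ) ∈ U → KeplerWave.HasFiniteSimpleZeros 1 L α β ρ) ∧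
    (∀ α β ρ : ℝ, α ^ 2 + β ^ 2 ≠ 0 → α * β * Real.sin ρ = 0 →
      KeplerWave.HasFiniteSimpleZeros 1 L α β ρ) := by
  refine ⟨⟨KeplerWave.genericWaves, KeplerWave.isOpen_genericWaves,
    KeplerWave.dense_genericWaves, fun α β ρ h =>
      KeplerWave.hasFiniteSimpleZeros_of_mem hL h.1 h.2⟩, fun α β ρ h0 h => ?_⟩
  have hF : 0 < KeplerWave.ampF α β ρ :=
    Real.sqrt_pos.2 (lt_of_le_of_ne (by nlinarith [sq_nonneg α, sq_nonneg β])
      fun h' => h0 (by linarith))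
  have hEF : KeplerWave.ampE α β ρ = KeplerWave.ampF α β ρ := by
    rw [KeplerWave.ampE, KeplerWave.ampF]
    congr 1
    linarith
  refine KeplerWave.hasFiniteSimpleZeros_of_mem hL hF ?_
  rw [hEF, div_self hF.ne']
  exact KeplerWave.one_mem_regularRatios
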